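/- Let $\theta_3(\tau)=\sum_{n\in\mathbb Z}e^{\pi i n^2\tau}$ and $\theta_2(\tau)=\sum_{n\in\mathbb Z}e^{\pi i (n-1/2)^2\tau}$ for $\operatorname{Im}\tau>0$. Let $l\ge 1$ be an odd integer, $k=2l$, $A=\frac{l+1}{2}$. For each $h$ prime to $k$ let $h'$ be any integer with $hh'\equiv-1\pmod k$, and put $$\gamma=\begin{pmatrix}h'&-\frac{hh'+1}{l}\\ l&-h\end{pmatrix},\qquad \gamma^{-1}=\begin{pmatrix}-h&\frac{hh'+1}{l}\\-l&h'\end{pmatrix}\in SL_2(\mathbb Z).$$ Let $\kappa(\gamma^{-1})$ be the theta multiplier, that is, the constant with $$\theta_3(\gamma^{-1}\tau)=\kappa(\gamma^{-1})\left(\frac{-l\tau+h'}{i}\right)^{1/2}\theta_2(\tau)\qquad(\operatorname{Im}\tau>0),$$ where the square root is the branch continuous in $\tau$ that is principal (equal to $i$ times a positive number) when $(-l\tau+h')/i$ is a negative real number. For $m\in\mathbb Z$ put $$A_k(m)=-i\sum_{h \bmod k,\ (h,k)=1}\kappa(\gamma^{-1})^3\,e^{-2\pi i\left(\frac{h'}{4k}+\frac{mh}{k}\right)}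 .$$ Then $$A_k(m)=(-1)^{m-1}\,i^{\frac{l-1}{2}}\,S(-4mA^3,A^3,l),$$ where $S$ is the Salié sum $$S(a,b,l)=\sum_{h \bmod l,\ (h,l)=1}\left(\frac hl\right)e^{\frac{2\pi i}{l}(ah+b\bar h)},\qquad h\bar h\equiv1\pmod l,$$ and $\left(\frac hl\right)$ is the Jacobi symbol. -/

import Mathlib

noncomputable section

/-- The theta constant `θ₂(τ) = ∑_{n ∈ ℤ} q^{(n - 1/2)²}`, `q = e^{π i τ}`. The theta constant
`θ₃(τ) = ∑_{n ∈ ℤ} q^{n²}` is Mathlib's `jacobiTheta`. -/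
def theta2 (τ : ℂ) : ℂ :=
  ∑' n : ℤ, Complex.exp (Real.pi * Complex.I * ((n : ℂ) - 1 / 2) ^ 2 * τ)

/-- The square root of the automorphy factor `(cτ + d) / i`, with the argument of `(cτ + d) / i`
taken in `(-π/2, 3π/2]`. For `c ≠ 0` it is holomorphic in `τ` on the upper half-plane. It is the
principal root if `c > 0`; if `c < 0` it is the principal root at the points where
`(cτ + d) / i` is a negative real number.
(The principal power on the right has base `-(cτ + d) = ((cτ + d) / i) / i`.) -/
def sqrtFactor (c d : ℤ) (τ : ℂ) : ℂ :=
  Complex.exp (Real.pi / 4 * Complex.I) * (-((c : ℂ) * τ + d)) ^ (1 / 2 : ℂ)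

/-- `κ` is the multiplier of `θ₃` for an integral matrix `g = (a, b; c, d)` of determinant one
with `a` and `c` odd (these are the `g` for which `θ₃ ∘ g` is a multiple of `θ₂`):
`θ₃((aτ + b) / (cτ + d)) = κ ((cτ + d) / i)^{1/2} θ₂(τ)` on the upper half-plane. -/
def IsThetaMultiplier (g : Matrix (Fin 2) (Fin 2) ℤ) (κ : ℂ) : Prop :=
  ∀ τ : ℂ, 0 < τ.im →
    jacobiTheta (((g 0 0 : ℂ) * τ + g 0 1) / ((g 1 0 : ℂ) * τ + g 1 1)) =
      κ * sqrtFactor (g 1 0) (g 1 1) τ * theta2 τ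

open Classical in
/-- The theta multiplier `κ(g)`. -/
def thetaMultiplier (g : Matrix (Fin 2) (Fin 2) ℤ) : ℂ :=
  if hg : ∃ κ, IsThetaMultiplier g κ then hg.choose else 0

/-- For `h h' ≡ -1 (mod 2l)`, the matrix `γ⁻¹ = (-h, (h h' + 1)/l; -l, h')`, which has determinant
one and maps `∞` to the cusp `h / l = 2h / k`, `k = 2l`. It is the inverse of
`γ = (h', -(h h' + 1)/l; l, -h)`. -/
def gammaInv (l : ℕ) (h h' : ℤ) : Matrix (Fin 2) (Fin 2) ℤ :=
  !![-h, (h * h' + 1) / (l : ℤ); -(l : ℤ), h']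

/-- `A_k(m) = -i ∑_{(h,k)=1} κ³(γ⁻¹) e^{-2πi (h'/(4k) + mh/k)}` for `k = 2l`, the sum over the
reduced residues `h` modulo `k`. The argument `h'` selects a solution of
`h h'(h) ≡ -1 (mod k)`. -/
def arithFactor (l : ℕ) (h' : ℕ → ℤ) (m : ℤ) : ℂ :=
  -Complex.I * ∑ h ∈ (Finset.range (2 * l)).filter (fun h => Nat.Coprime h (2 * l)),
    thetaMultiplier (gammaInv l (h : ℤ) (h' h)) ^ 3 *
      Complex.exp (-2 * Real.pi * Complex.I *
        ((h' h : ℂ) / (4 * (2 * (l : ℂ))) + (m : ℂ) * (h : ℂ) / (2 * (l : ℂ))))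

/-- The Salié sum `S(a, b, l) = ∑_{(h,l)=1} (h/l) e^{(2πi/l)(a h + b h̄)}`, where `(h/l)` is the
Jacobi symbol, the sum is over the reduced residues `h` modulo `l`, and `h h̄ ≡ 1 (mod l)`. -/
def salieSum (a b : ℤ) (l : ℕ) : ℂ :=
  ∑ h ∈ (Finset.range l).filter (fun h => Nat.Coprime h l),
    (jacobiSym (h : ℤ) l : ℂ) *
      Complex.exp (2 * Real.pi * Complex.I / (l : ℂ) *
        ((a : ℂ) * (h : ℂ) + (b : ℂ) * (((h : ZMod l)⁻¹).val : ℂ)))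

end

open Complex Filter Topology
open scoped ComplexConjugate NumberTheorySymbols

/-- The quadratic Gauss sum `∑_{r mod N} e^{2πi (a r² + j r) / N}`. -/
noncomputable def quadGaussSum (N : ℕ) [NeZero N] (a j : ZMod N) : ℂ :=
  ∑ r : ZMod N, ZMod.stdAddChar (a * r ^ 2 + j * r)

theorem hasSum_int_of_residues {N : ℕ} [NeZero N] {f : ℤ → ℂ} {F : ZMod N → ℂ}
    (hf : Summable f) (h : ∀ r : ZMod N, HasSum (fun q : ℤ => f (q * N + r.val)) (F r)) :
    HasSum f (∑ r, F r) := by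
  obtain ⟨n, rfl⟩ : ∃ n, N = n + 1 := Nat.exists_eq_succ_of_ne_zero (NeZero.ne N)
  let e : ZMod (n + 1) × ℤ ≃ ℤ :=
    (Equiv.prodComm _ _).trans (Int.divModEquiv (n + 1)).symm
  have h1 : HasSum (f ∘ e) (∑' x, f x) := e.hasSum_iff.mpr hf.hasSum
  have h2 := h1.prod_fiberwise (g := F) (fun r => h r)
  have h3 := h2.unique (hasSum_fintype F)
  rw [← h3]
  exact hf.hasSum

theorem ofReal_mul_cpow_half {c : ℝ} (hc : 0 < c) (x : ℂ) :
    ((c : ℂ) * x) ^ (1 / 2 : ℂ) = (√c : ℝ) * x ^ (1 / 2 : ℂ) := by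
  rcases eq_or_ne x 0 with rfl | hx
  · simp
  have hc' : (c : ℂ) ≠ 0 := by exact_mod_cast hc.ne'
  rw [cpow_def_of_ne_zero (mul_ne_zero hc' hx), cpow_def_of_ne_zero hx, log_ofReal_mul hc hx,
    add_mul, Complex.exp_add, Real.sqrt_eq_rpow, ofReal_cpow hc.le, cpow_def_of_ne_zero hc',
    ofReal_log hc.le]
  simp

theorem summable_jacobiTheta {τ : ℂ} (hτ : 0 < τ.im) :
    Summable fun n : ℤ => cexp (Real.pi * I * (n : ℂ) ^ 2 * τ) := by
  simpa [jacobiTheta₂_term] using (hasSum_jacobiTheta₂_term 0 hτ).summable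

theorem exp_quadratic_eq_stdAddChar (N : ℕ) [NeZero N] (a q : ℤ) (r : ZMod N) :
    cexp (Real.pi * I * ((q * N + r.val : ℤ) : ℂ) ^ 2 * (2 * a / N)) =
      ZMod.stdAddChar (a * r ^ 2 : ZMod N) := by
  have h : (a * r ^ 2 : ZMod N) = ((a * (q * N + r.val) ^ 2 : ℤ) : ZMod N) := by
    push_cast
    simp
  rw [h, ZMod.stdAddChar_coe]
  congr 1
  push_cast
  ring

theorem jacobiTheta_near_rational (N : ℕ) [NeZero N] (a : ℤ) {z : ℂ} (hz : 0 < z.im) :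
    jacobiTheta (2 * a / N + z) = 1 / (N * (-I * z) ^ (1 / 2 : ℂ)) *
      ∑ r : ZMod N, ZMod.stdAddChar (a * r ^ 2 : ZMod N) *
        jacobiTheta₂ (r.val / N) (-1 / (N ^ 2 * z)) := by
  have hN : (N : ℂ) ≠ 0 := by exact_mod_cast NeZero.ne N
  have hN' : (0 : ℝ) < N := by exact_mod_cast Nat.pos_of_neZero N
  have hz0 : z ≠ 0 := by rintro rfl; simp at hz
  have him : 0 < (2 * a / N + z : ℂ).im := by
    have : (2 * a / N : ℂ) = ((2 * a / N : ℝ) : ℂ) := by push_cast; ring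
    rw [this, add_im, ofReal_im, zero_add]
    exact hz
  have himN : 0 < ((N : ℂ) ^ 2 * z).im := by
    have : ((N : ℂ) ^ 2) = ((N ^ 2 : ℝ) : ℂ) := by push_cast; ring
    rw [this, im_ofReal_mul]
    positivity
  rw [Finset.mul_sum]
  refine (hasSum_int_of_residues (N := N) (summable_jacobiTheta him) fun r => ?_).tsum_eq
  have hs := (hasSum_jacobiTheta₂_term (N * r.val * z) himN).mul_left
    (ZMod.stdAddChar (a * r ^ 2 : ZMod N) * cexp (Real.pi * I * (r.val : ℂ) ^ 2 * z))
  rw [show 1 / (N * (-I * z) ^ (1 / 2 : ℂ)) * (ZMod.stdAddChar (a * r ^ 2 : ZMod N) *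
      jacobiTheta₂ (r.val / N) (-1 / (N ^ 2 * z))) = ZMod.stdAddChar (a * r ^ 2 : ZMod N) *
      cexp (Real.pi * I * (r.val : ℂ) ^ 2 * z) * jacobiTheta₂ (N * r.val * z) (N ^ 2 * z) from ?_]
  · refine Eq.mpr (congrArg (HasSum · _) (funext fun q => ?_)) hs
    rw [mul_add (Real.pi * I * _ : ℂ), Complex.exp_add, exp_quadratic_eq_stdAddChar, jacobiTheta₂_term,
      mul_assoc (ZMod.stdAddChar _), ← Complex.exp_add]
    congr 2
    push_cast
    ring
  · rw [jacobiTheta₂_functional_equation (N * r.val * z)]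
    have e1 : (-I * ((N : ℂ) ^ 2 * z)) ^ (1 / 2 : ℂ) = N * (-I * z) ^ (1 / 2 : ℂ) := by
      rw [show -I * ((N : ℂ) ^ 2 * z) = (((N : ℝ) ^ 2 : ℝ) : ℂ) * (-I * z) by push_cast; ring,
        ofReal_mul_cpow_half (by positivity), Real.sqrt_sq hN'.le]
      simp
    have e2 : -(Real.pi : ℂ) * I * (N * r.val * z) ^ 2 / (N ^ 2 * z) =
        -(Real.pi * I * (r.val : ℂ) ^ 2 * z) := by
      field_simp
    have e3 : (N * r.val * z : ℂ) / (N ^ 2 * z) = r.val / N := by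
      field_simp
    rw [e1, e2, e3, Complex.exp_neg]
    have := Complex.exp_ne_zero (Real.pi * I * (r.val : ℂ) ^ 2 * z)
    generalize cexp (Real.pi * I * (r.val : ℂ) ^ 2 * z) = E at *
    field_simp

theorem hasSum_quadGaussSum (N : ℕ) [NeZero N] (a : ZMod N) {τ : ℂ} (hτ : 0 < τ.im) :
    HasSum (fun j : ℤ => quadGaussSum N a j * cexp (Real.pi * I * (j : ℂ) ^ 2 * τ))
      (∑ r : ZMod N, ZMod.stdAddChar (a * r ^ 2 : ZMod N) * jacobiTheta₂ (r.val / N) τ) := by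
  have h := hasSum_sum (s := (Finset.univ : Finset (ZMod N))) fun r _ =>
    (hasSum_jacobiTheta₂_term (r.val / N : ℂ) hτ).mul_left (ZMod.stdAddChar (a * r ^ 2 : ZMod N))
  refine Eq.mpr (congrArg (HasSum · _) (funext fun j => ?_)) h
  rw [quadGaussSum, Finset.sum_mul]
  refine Finset.sum_congr rfl fun r _ => ?_
  rw [AddChar.map_add_eq_mul, jacobiTheta₂_term, Complex.exp_add, ← mul_assoc]
  congr 2
  have : (j * r : ZMod N) = ((j * r.val : ℤ) : ZMod N) := by push_cast; simp
  rw [this, ZMod.stdAddChar_coe]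
  congr 1
  push_cast
  ring

theorem jacobiTheta_near_rational' (N : ℕ) [NeZero N] (a : ℤ) {z : ℂ} (hz : 0 < z.im) :
    jacobiTheta (2 * a / N + z) = 1 / (N * (-I * z) ^ (1 / 2 : ℂ)) *
      ∑' j : ℤ, quadGaussSum N a j * cexp (Real.pi * I * (j : ℂ) ^ 2 * (-1 / (N ^ 2 * z))) := by
  have him : 0 < (-1 / ((N : ℂ) ^ 2 * z)).im := by
    have hN' : (0 : ℝ) < N := by exact_mod_cast Nat.pos_of_neZero N
    have hz0 : z ≠ 0 := by rintro rfl; simp at hz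
    have : -1 / ((N : ℂ) ^ 2 * z) = (((N : ℝ) ^ 2)⁻¹ : ℝ) * (-z⁻¹) := by
      push_cast
      field_simp
    rw [this, im_ofReal_mul, neg_im, inv_im, neg_div, neg_neg]
    have := normSq_pos.mpr hz0
    positivity
  rw [jacobiTheta_near_rational N a hz, (hasSum_quadGaussSum N a him).tsum_eq]

theorem norm_quadGaussSum_le (N : ℕ) [NeZero N] (a j : ZMod N) : ‖quadGaussSum N a j‖ ≤ N := by
  refine (norm_sum_le _ _).trans ?_
  simp [AddChar.norm_apply]

theorem tendsto_tsum_quadGaussSum (N : ℕ) [NeZero N] (a : ZMod N) :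
    Tendsto (fun τ : ℂ => ∑' j : ℤ, quadGaussSum N a j * cexp (Real.pi * I * (j : ℂ) ^ 2 * τ))
      (comap Complex.im atTop) (𝓝 (quadGaussSum N a 0)) := by
  have hsum : Summable fun j : ℤ => (N : ℝ) * ‖cexp (Real.pi * I * (j : ℂ) ^ 2 * I)‖ :=
    (summable_jacobiTheta (by simp)).norm.mul_left _
  have hnorm : ∀ (j : ℤ) (τ : ℂ), ‖cexp (Real.pi * I * (j : ℂ) ^ 2 * τ)‖ =
      Real.exp (-(Real.pi * (j : ℝ) ^ 2 * τ.im)) := by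
    intro j τ
    rw [Complex.norm_exp]
    congr 1
    have : (Real.pi * I * (j : ℂ) ^ 2 * τ) = ((Real.pi * (j : ℝ) ^ 2 : ℝ) : ℂ) * (I * τ) := by
      push_cast; ring
    rw [this, re_ofReal_mul]
    simp
  have := tendsto_tsum_of_dominated_convergence (𝓕 := comap Complex.im atTop)
    (f := fun (τ : ℂ) (j : ℤ) => quadGaussSum N a j * cexp (Real.pi * I * (j : ℂ) ^ 2 * τ))
    (g := fun j : ℤ => if j = 0 then quadGaussSum N a 0 else 0) hsum ?_ ?_
  · simpa using this
  · intro j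
    split_ifs with hj
    · subst hj
      simpa using tendsto_const_nhds
    · have h0 : Tendsto (fun τ : ℂ => cexp (Real.pi * I * (j : ℂ) ^ 2 * τ))
          (comap Complex.im atTop) (𝓝 0) := by
        rw [tendsto_zero_iff_norm_tendsto_zero]
        simp_rw [hnorm]
        have hp : 0 < Real.pi * (j : ℝ) ^ 2 := by
          have : (j : ℝ) ≠ 0 := by exact_mod_cast hj
          positivity
        exact Real.tendsto_exp_neg_atTop_nhds_zero.comp (tendsto_comap.const_mul_atTop hp)
      simpa using h0.const_mul (quadGaussSum N a j)
  · filter_upwards [tendsto_comap.eventually (eventually_ge_atTop (1 : ℝ))] with τ hτ j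
    rw [norm_mul, hnorm, hnorm, I_im]
    gcongr
    exact norm_quadGaussSum_le N a j

theorem neg_I_cpow_half : (-I) ^ (1 / 2 : ℂ) = cexp (-(Real.pi / 4 * I)) := by
  rw [cpow_def_of_ne_zero (by simp), log_neg_I]
  congr 1
  ring

theorem im_ofReal_add_mul_I (x t : ℝ) : ((x : ℂ) + t * I).im = t := by simp

theorem neg_one_div_im_pos {τ : ℂ} (hτ : 0 < τ.im) : 0 < (-1 / τ).im := by
  have h0 : τ ≠ 0 := by rintro rfl; simp at hτ
  rw [neg_div, neg_im, one_div, inv_im, neg_div, neg_neg]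
  have := normSq_pos.mpr h0
  positivity

theorem jacobiTheta_neg_one_div (τ : ℂ) :
    jacobiTheta τ = 1 / (-I * τ) ^ (1 / 2 : ℂ) * jacobiTheta (-1 / τ) := by
  simpa [jacobiTheta_eq_jacobiTheta₂] using jacobiTheta₂_functional_equation 0 τ

/-- The Landsberg–Schaar relation before passing to the limit at the cusp `2b / l`. -/
theorem tsum_quadGaussSum_reciprocity (b l : ℕ) [NeZero b] [NeZero l] [NeZero (4 * b)]
    {t : ℝ} (ht : 0 < t) :
    (∑' j : ℤ, quadGaussSum l b j * cexp (Real.pi * I * (j : ℂ) ^ 2 *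
      (((1 / (l ^ 2 * t) : ℝ) : ℂ) * I))) * (4 * b) *
        (-I * ((2 * b / l : ℝ) + t * I)) ^ (1 / 2 : ℂ) *
        ((l : ℂ) / (2 * b * ((2 * b / l : ℝ) + t * I))) ^ (1 / 2 : ℂ) =
      l * ∑' j : ℤ, quadGaussSum (4 * b) (-l) j * cexp (Real.pi * I * (j : ℂ) ^ 2 *
        ((-1 / (8 * b * l) : ℝ) + ((1 / (4 * l ^ 2 * t) : ℝ) : ℂ) * I)) := by
  have hb : (0 : ℝ) < b := by exact_mod_cast Nat.pos_of_neZero b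
  have hl : (0 : ℝ) < l := by exact_mod_cast Nat.pos_of_neZero l
  have hbc : (b : ℂ) ≠ 0 := by exact_mod_cast hb.ne'
  have hlc : (l : ℂ) ≠ 0 := by exact_mod_cast hl.ne'
  have htc : (t : ℂ) ≠ 0 := by exact_mod_cast ht.ne'
  set τ : ℂ := (2 * b / l : ℝ) + t * I with hτdef
  have hτ : 0 < τ.im := by rw [hτdef, im_ofReal_add_mul_I]; exact ht
  have hτ0 : τ ≠ 0 := by rintro h; simp [h] at hτ
  have hτ1 : l * τ = 2 * b + l * t * I := by
    rw [hτdef]; push_cast; field_simp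
  have e1 : (2 * (b : ℤ) / l + t * I : ℂ) = τ := by rw [hτdef]; push_cast; ring
  clear_value τ
  have h1 := jacobiTheta_near_rational' l b (z := t * I) (by simpa using ht)
  have hz' : 0 < (-1 / τ + ((l / (2 * b) : ℝ) : ℂ)).im := by
    rw [add_im, ofReal_im, add_zero]; exact neg_one_div_im_pos hτ
  have hz'eq : -1 / τ + ((l / (2 * b) : ℝ) : ℂ) = I * (t * (l / (2 * b * τ))) := by
    push_cast
    field_simp
    linear_combination hτ1
  have h2 := jacobiTheta_near_rational' (4 * b) (-l) hz'
  have e2 : (2 * ((-l : ℤ) : ℂ) / ((4 * b : ℕ) : ℂ) + (-1 / τ + ((l / (2 * b) : ℝ) : ℂ))) =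
      -1 / τ := by
    push_cast
    field_simp
    ring
  have e3 : -1 / ((l : ℂ) ^ 2 * (t * I)) = ((1 / (l ^ 2 * t) : ℝ) : ℂ) * I := by
    push_cast
    field_simp
    simp
  have e4 : -1 / (((4 * b : ℕ) : ℂ) ^ 2 * (I * (t * (l / (2 * b * τ))))) =
      (-1 / (8 * b * l) : ℝ) + ((1 / (4 * l ^ 2 * t) : ℝ) : ℂ) * I := by
    have : -1 / (((4 * b : ℕ) : ℂ) ^ 2 * (I * (t * (l / (2 * b * τ))))) =
        I * (l * τ) / (8 * b * l ^ 2 * t) := by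
      push_cast
      field_simp
      linear_combination (-16 : ℂ) * I_sq
    rw [this, hτ1]
    push_cast
    field_simp
    linear_combination (4 * l * t : ℂ) * I_sq
  have e5 : (-I * (t * I)) ^ (1 / 2 : ℂ) = (√t : ℝ) := by
    rw [show -I * (t * I) = (t : ℂ) * 1 by ring_nf; simp, ofReal_mul_cpow_half ht]
    simp
  have e6 : (-I * (I * (t * (l / (2 * b * τ))))) ^ (1 / 2 : ℂ) =
      (√t : ℝ) * (l / (2 * b * τ)) ^ (1 / 2 : ℂ) := by
    rw [← ofReal_mul_cpow_half ht]
    congr 1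
    linear_combination (-(t * (l / (2 * b * τ))) : ℂ) * I_sq
  rw [e1, e3, e5] at h1
  rw [e2, hz'eq, e4, e6] at h2
  have h3 := jacobiTheta_neg_one_div τ
  rw [h1, h2] at h3
  have hst : ((√t : ℝ) : ℂ) ≠ 0 := by exact_mod_cast (Real.sqrt_pos.mpr ht).ne'
  have hc1 : (-I * τ) ^ (1 / 2 : ℂ) ≠ 0 := by
    rw [Ne, cpow_eq_zero_iff]; simp [hτ0]
  have hc2 : ((l : ℂ) / (2 * b * τ)) ^ (1 / 2 : ℂ) ≠ 0 := by
    rw [Ne, cpow_eq_zero_iff]; simp [hτ0, hbc, hlc]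
  simp only [Int.cast_neg, Int.cast_natCast] at h3
  generalize (∑' j : ℤ, quadGaussSum l b j * cexp (Real.pi * I * (j : ℂ) ^ 2 *
      (((1 / (l ^ 2 * t) : ℝ) : ℂ) * I))) = F at *
  generalize (∑' j : ℤ, quadGaussSum (4 * b) (-l) j * cexp (Real.pi * I * (j : ℂ) ^ 2 *
        ((-1 / (8 * b * l) : ℝ) + ((1 / (4 * l ^ 2 * t) : ℝ) : ℂ) * I))) = G at *
  push_cast at h3
  generalize (-I * τ) ^ (1 / 2 : ℂ) = c1 at *
  generalize ((l : ℂ) / (2 * b * τ)) ^ (1 / 2 : ℂ) = c2 at *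
  field_simp at h3
  linear_combination h3

/-- The Landsberg–Schaar relation. -/
theorem quadGaussSum_reciprocity (b l : ℕ) [NeZero b] [NeZero l] [NeZero (4 * b)] :
    quadGaussSum l b 0 * (2 * (√(2 * b) : ℝ)) =
      cexp (Real.pi / 4 * I) * (√l : ℝ) * quadGaussSum (4 * b) (-l) 0 := by
  have hb : (0 : ℝ) < b := by exact_mod_cast Nat.pos_of_neZero b
  have hl : (0 : ℝ) < l := by exact_mod_cast Nat.pos_of_neZero l
  have hbc : (b : ℂ) ≠ 0 := by exact_mod_cast hb.ne'
  have hlc : (l : ℂ) ≠ 0 := by exact_mod_cast hl.ne'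
  have hinv : ∀ c : ℝ, 0 < c → Tendsto (fun t : ℝ => 1 / (c * t)) (𝓝[>] 0) atTop := by
    intro c hc
    have := tendsto_inv_nhdsGT_zero (𝕜 := ℝ)
    refine (this.const_mul_atTop (inv_pos.mpr hc)).congr fun t => ?_
    rw [one_div, mul_inv]
  have hL := (tendsto_tsum_quadGaussSum l b).comp (tendsto_comap_iff.mpr
    (show Tendsto (Complex.im ∘ fun t : ℝ => ((1 / (l ^ 2 * t) : ℝ) : ℂ) * I) (𝓝[>] 0) atTop by
      refine (hinv (l ^ 2) (by positivity)).congr fun t => ?_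
      rw [Function.comp_apply, im_ofReal_mul, I_im, mul_one]))
  have hR := (tendsto_tsum_quadGaussSum (4 * b) (-l)).comp (tendsto_comap_iff.mpr
    (show Tendsto (Complex.im ∘ fun t : ℝ => (((-1 / (8 * b * l) : ℝ) : ℂ) +
        ((1 / (4 * l ^ 2 * t) : ℝ) : ℂ) * I)) (𝓝[>] 0) atTop by
      refine (hinv (4 * l ^ 2) (by positivity)).congr fun t => ?_
      rw [Function.comp_apply, im_ofReal_add_mul_I]))
  have hτ : Tendsto (fun t : ℝ => (((2 * b / l : ℝ) : ℂ) + t * I)) (𝓝[>] 0)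
      (𝓝 ((2 * b / l : ℝ) : ℂ)) := by
    have : Continuous fun t : ℝ => (((2 * b / l : ℝ) : ℂ) + t * I) := by fun_prop
    simpa using (this.tendsto 0).mono_left nhdsWithin_le_nhds
  have hτ0 : ((2 * b / l : ℝ) : ℂ) ≠ 0 := by
    exact_mod_cast (show (0 : ℝ) < 2 * b / l by positivity).ne'
  have h1 : Tendsto (fun t : ℝ => (-I * (((2 * b / l : ℝ) : ℂ) + t * I)) ^ (1 / 2 : ℂ)) (𝓝[>] 0)
      (𝓝 ((√(2 * b / l) : ℝ) * cexp (-(Real.pi / 4 * I)))) := by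
    rw [← neg_I_cpow_half, ← ofReal_mul_cpow_half (by positivity), mul_comm _ (-I)]
    refine (continuousAt_cpow_const (Or.inr ?_)).tendsto.comp (hτ.const_mul (-I))
    rw [mul_comm, im_ofReal_mul]
    simp [hb.ne', hl.ne']
  have h2 : Tendsto (fun t : ℝ => ((l : ℂ) / (2 * b * (((2 * b / l : ℝ) : ℂ) + t * I))) ^
      (1 / 2 : ℂ)) (𝓝[>] 0) (𝓝 (l / (2 * b))) := by
    have hlim : ((l : ℂ) / (2 * b * ((2 * b / l : ℝ) : ℂ))) =
        (((l / (2 * b) : ℝ) ^ 2 : ℝ) : ℂ) * 1 := by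
      push_cast
      field_simp
    have : ((l : ℂ) / (2 * b)) = ((l : ℂ) / (2 * b * ((2 * b / l : ℝ) : ℂ))) ^ (1 / 2 : ℂ) := by
      rw [hlim, ofReal_mul_cpow_half (by positivity), Real.sqrt_sq (by positivity)]
      simp
    rw [this]
    refine (continuousAt_cpow_const ?_).tendsto.comp (tendsto_const_nhds.div (hτ.const_mul _) ?_)
    · rw [hlim, mul_one]
      exact ofReal_mem_slitPlane.mpr (by positivity)
    · exact mul_ne_zero (by simpa using hbc) hτ0
  have hlim := ((hL.mul_const (4 * b : ℂ)).mul h1).mul h2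
  have key := tendsto_nhds_unique (hlim.congr' ?_) (hR.const_mul (l : ℂ))
  · rw [Complex.exp_neg, Real.sqrt_div (by positivity)] at key
    have hsl : ((√l : ℝ) : ℂ) ≠ 0 := by exact_mod_cast (Real.sqrt_pos.mpr hl).ne'
    have hE := Complex.exp_ne_zero (Real.pi / 4 * I)
    push_cast at key ⊢
    generalize cexp (Real.pi / 4 * I) = E at *
    field_simp at key
    linear_combination key / 2
  · filter_upwards [self_mem_nhdsWithin] with t ht
    exact tsum_quadGaussSum_reciprocity b l ht

/-- The factor `ε_l` in the evaluation of quadratic Gauss sums: `1` if `l ≡ 1 (mod 4)`, else `i`. -/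
noncomputable def gaussEps (l : ℕ) : ℂ := if l % 4 = 1 then 1 else I

theorem quadGaussSum_neg (N : ℕ) [NeZero N] (a : ZMod N) :
    quadGaussSum N (-a) 0 = conj (quadGaussSum N a 0) := by
  simp only [quadGaussSum, map_sum, ← AddChar.map_neg_eq_conj]
  refine Finset.sum_congr rfl fun r _ => ?_
  congr 1
  ring

theorem quadGaussSum_sub_modulus {b l l' : ℕ} [NeZero b] [NeZero l] [NeZero l'] [NeZero (4 * b)]
    (h : l = l' + 4 * b) :
    quadGaussSum l b 0 * (√l' : ℝ) = (√l : ℝ) * quadGaussSum l' b 0 := by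
  have hb : (0 : ℝ) < b := by exact_mod_cast Nat.pos_of_neZero b
  have h1 := quadGaussSum_reciprocity b l
  have h2 := quadGaussSum_reciprocity b l'
  have hc : (l : ZMod (4 * b)) = l' := by
    rw [h, Nat.cast_add, ZMod.natCast_self, add_zero]
  rw [hc] at h1
  have hs : ((√(2 * b) : ℝ) : ℂ) ≠ 0 := by
    exact_mod_cast (Real.sqrt_pos.mpr (by positivity : (0 : ℝ) < 2 * b)).ne'
  refine mul_right_cancel₀ (mul_ne_zero two_ne_zero hs) ?_
  linear_combination ((√l' : ℝ) : ℂ) * h1 - ((√l : ℝ) : ℂ) * h2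

theorem quadGaussSum_modulus_sub {b l l' : ℕ} [NeZero b] [NeZero l] [NeZero l'] [NeZero (4 * b)]
    (h : l + l' = 4 * b) :
    quadGaussSum l b 0 * (√l' : ℝ) = I * (√l : ℝ) * conj (quadGaussSum l' b 0) := by
  have hb : (0 : ℝ) < b := by exact_mod_cast Nat.pos_of_neZero b
  have h1 := quadGaussSum_reciprocity b l
  have h2 := congrArg conj (quadGaussSum_reciprocity b l')
  have hc : (l : ZMod (4 * b)) = -l' := by
    rw [eq_neg_iff_add_eq_zero, ← Nat.cast_add, h, ZMod.natCast_self]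
  rw [hc, neg_neg] at h1
  rw [quadGaussSum_neg] at h2
  simp only [map_mul, conj_ofReal, map_ofNat, Complex.conj_conj, ← Complex.exp_conj, map_div₀,
    conj_I] at h2
  have hE : cexp (Real.pi / 4 * I) = I * cexp (Real.pi / 4 * -I) := by
    nth_rewrite 2 [← exp_pi_div_two_mul_I]
    rw [← Complex.exp_add]
    congr 1
    ring
  have hs : ((√(2 * b) : ℝ) : ℂ) ≠ 0 := by
    exact_mod_cast (Real.sqrt_pos.mpr (by positivity : (0 : ℝ) < 2 * b)).ne'
  refine mul_right_cancel₀ (mul_ne_zero two_ne_zero hs) ?_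
  rw [hE] at h1
  linear_combination ((√l' : ℝ) : ℂ) * h1 - I * ((√l : ℝ) : ℂ) * h2

theorem jacobiSym_four_mul (b : ℤ) {l : ℕ} (hl : Odd l) : J(4 * b | l) = J(b | l) := by
  rw [jacobiSym.mul_left, jacobiSym.at_four hl, one_mul]

theorem jacobiSym_modulus_sub {b l l' : ℕ} (hl : Odd l) (hl' : Odd l') (h : l + l' = 4 * b) :
    J(b | l) = J(b | l') := by
  have h1 : J(b | l) = J(l' | l) := by
    rw [← jacobiSym_four_mul b hl]
    refine jacobiSym.mod_left' ?_
    have : (4 * b : ℤ) = l' + l := by exact_mod_cast (by omega : 4 * b = l' + l)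
    rw [this, Int.add_emod_right]
  have h2 : J(b | l') = J(l | l') := by
    rw [← jacobiSym_four_mul b hl']
    refine jacobiSym.mod_left' ?_
    have : (4 * b : ℤ) = l + l' := by exact_mod_cast h.symm
    rw [this, Int.add_emod_right]
  rw [h1, h2]
  rcases Nat.odd_mod_four_iff.mp (Nat.odd_iff.mp hl) with h4 | h4
  · exact jacobiSym.quadratic_reciprocity_one_mod_four' hl' h4
  · exact jacobiSym.quadratic_reciprocity_one_mod_four (by omega) hl

theorem gaussEps_neg {l : ℕ} (hl : Odd l) (b : ℤ) :
    conj (J(b | l) * gaussEps l : ℂ) = J(-b | l) * gaussEps l := by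
  rw [jacobiSym.neg b hl, gaussEps]
  rcases Nat.odd_mod_four_iff.mp (Nat.odd_iff.mp hl) with h4 | h4
  · simp [ZMod.χ₄_nat_one_mod_four h4, h4]
  · simp [ZMod.χ₄_nat_three_mod_four h4, h4]

theorem quadGaussSum_eq_of_natCast {l : ℕ} [NeZero l] (hl : Odd l) (h1 : 1 < l)
    (ih : ∀ l' < l, ∀ [NeZero l'], Odd l' → ∀ b : ℤ, IsCoprime b l' →
      quadGaussSum l' b 0 = J(b | l') * gaussEps l' * (√l' : ℝ))
    {b : ℕ} (hb : IsCoprime (b : ℤ) l) (hbl : 2 * b ≤ l) :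
    quadGaussSum l b 0 = J(b | l) * gaussEps l * (√l : ℝ) := by
  have hb0 : b ≠ 0 := by
    rintro rfl
    have := Nat.isCoprime_iff_coprime.mp hb
    rw [Nat.coprime_zero_left] at this
    omega
  have : NeZero b := ⟨hb0⟩
  have : NeZero (4 * b) := ⟨by omega⟩
  have hlo := Nat.odd_iff.mp hl
  rcases lt_or_ge (4 * b) l with hlt | hge
  · obtain ⟨l', rfl⟩ : ∃ l', l = l' + 4 * b := ⟨l - 4 * b, by omega⟩
    have : NeZero l' := ⟨by omega⟩
    have hl' : Odd l' := Nat.odd_iff.mpr (by omega)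
    have hcop : IsCoprime (b : ℤ) l' := by
      have : ((l' + 4 * b : ℕ) : ℤ) = l' + b * 4 := by push_cast; ring
      rw [this] at hb
      exact IsCoprime.add_mul_left_right_iff.mp hb
    have hg := quadGaussSum_sub_modulus (b := b) (l := l' + 4 * b) (l' := l') rfl
    have hi := ih l' (by omega) hl' b hcop
    rw [Int.cast_natCast] at hi
    have hJ : J(b | l' + 4 * b) = J(b | l') := by
      rw [jacobiSym.mod_right' b hl, jacobiSym.mod_right' b hl', Nat.add_mod_right]
    have he : gaussEps (l' + 4 * b) = gaussEps l' := by
      simp [gaussEps, Nat.add_mul_mod_self_left]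
    have hs : ((√l' : ℝ) : ℂ) ≠ 0 := by
      exact_mod_cast (Real.sqrt_pos.mpr (by exact_mod_cast Nat.pos_of_neZero l')).ne'
    refine mul_right_cancel₀ hs ?_
    rw [hg, hi, hJ, he]
    ring
  · obtain ⟨l', hll⟩ : ∃ l', l + l' = 4 * b := ⟨4 * b - l, by omega⟩
    have : NeZero l' := ⟨by omega⟩
    have hl' : Odd l' := Nat.odd_iff.mpr (by omega)
    have hcop : IsCoprime (b : ℤ) l' := by
      have : (l' : ℤ) = -l + b * 4 := by
        have : (l : ℤ) + l' = 4 * b := by exact_mod_cast hll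
        linear_combination this
      rw [this]
      exact IsCoprime.add_mul_left_right_iff.mpr hb.neg_right
    have hg := quadGaussSum_modulus_sub hll
    have hi := ih l' (by omega) hl' b hcop
    rw [Int.cast_natCast] at hi
    have hs : ((√l' : ℝ) : ℂ) ≠ 0 := by
      exact_mod_cast (Real.sqrt_pos.mpr (by exact_mod_cast Nat.pos_of_neZero l')).ne'
    have he : I * conj (gaussEps l') = gaussEps l := by
      rcases Nat.odd_mod_four_iff.mp hlo with h4 | h4
      · simp [gaussEps, h4, (by omega : l' % 4 = 3)]
      · simp [gaussEps, h4, (by omega : l' % 4 = 1)]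
    refine mul_right_cancel₀ hs ?_
    rw [hg, hi, jacobiSym_modulus_sub hl hl' hll, ← he]
    simp only [map_mul, conj_ofReal, map_intCast]
    ring

/-- Gauss's evaluation of the quadratic Gauss sum to an odd modulus. -/
theorem quadGaussSum_eq (l : ℕ) [NeZero l] (hl : Odd l) (b : ℤ) (hb : IsCoprime b l) :
    quadGaussSum l b 0 = J(b | l) * gaussEps l * (√l : ℝ) := by
  revert ‹NeZero l›
  induction l using Nat.strong_induction_on generalizing b with
  | _ l ih =>
  intro _
  rcases (Nat.one_le_iff_ne_zero.mpr (NeZero.ne l)).eq_or_lt with rfl | h1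
  · simp [quadGaussSum, gaussEps, Subsingleton.elim _ (0 : ZMod 1)]
  set c := Int.bmod b l with hc
  have hmod : c % l = b % l := Int.bmod_emod
  have hbc : (b : ZMod l) = c := ((ZMod.intCast_eq_intCast_iff _ _ _).mpr hmod).symm
  have hcop : IsCoprime c l := by
    have : c = b + l * (c / l - b / l) := by
      linear_combination -(Int.emod_add_mul_ediv c l) + Int.emod_add_mul_ediv b l + hmod
    rw [this]
    exact hb.add_mul_left_left _
  have hle : 2 * c.natAbs ≤ l := by
    have h2 := Int.bmod_lt (x := b) (m := l) (by omega)
    have h3 := Int.le_bmod (x := b) (m := l) (by omega)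
    omega
  rw [hbc, jacobiSym.mod_left' hmod.symm]
  rcases Int.natAbs_eq c with hpos | hneg
  · rw [hpos] at hcop ⊢
    rw [Int.cast_natCast]
    exact quadGaussSum_eq_of_natCast hl h1 (fun l' h _ ho b hb => ih l' h ho b hb) hcop hle
  · rw [hneg] at hcop ⊢
    have := quadGaussSum_eq_of_natCast hl h1 (fun l' h _ ho b hb => ih l' h ho b hb) (by simpa using hcop.neg_left) hle
    rw [Int.cast_neg, Int.cast_natCast, quadGaussSum_neg, this, map_mul, gaussEps_neg hl,
      conj_ofReal]

theorem ZMod.sum_univ_eq_sum_range {M : Type*} [AddCommMonoid M] (N : ℕ) [NeZero N]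
    (F : ZMod N → M) : ∑ r, F r = ∑ x ∈ Finset.range N, F (x : ZMod N) := by
  obtain ⟨n, rfl⟩ : ∃ n, N = n + 1 := Nat.exists_eq_succ_of_ne_zero (NeZero.ne N)
  rw [← Fin.sum_univ_eq_sum_range (fun x => F (x : ZMod (n + 1)))]
  exact Finset.sum_congr rfl fun r _ => congrArg F (ZMod.natCast_zmod_val (n := n + 1) r).symm

theorem exp_pi_mul_int_div (l : ℕ) [NeZero l] {A : ℕ} (hA : 2 * A = l + 1) (n : ℤ) :
    cexp (Real.pi * I * n / l) = (-1) ^ n * ZMod.stdAddChar ((A * n : ℤ) : ZMod l) := by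
  have hl : (l : ℂ) ≠ 0 := by exact_mod_cast NeZero.ne l
  have hA' : (2 * A : ℂ) = l + 1 := by exact_mod_cast hA
  rw [ZMod.stdAddChar_coe, ← inv_neg_one, inv_zpow', ← exp_pi_mul_I, ← Complex.exp_int_mul,
    ← Complex.exp_add]
  congr 1
  push_cast
  field_simp
  linear_combination (-(n : ℂ)) * hA'

theorem stdAddChar_two_mul_modulus (l : ℕ) [NeZero l] [NeZero (2 * l)] (n : ℤ) :
    ZMod.stdAddChar ((n : ℤ) : ZMod (2 * l)) = cexp (Real.pi * I * n / l) := by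
  have hl : (l : ℂ) ≠ 0 := by exact_mod_cast NeZero.ne l
  rw [ZMod.stdAddChar_coe]
  congr 1
  push_cast
  field_simp

theorem two_mul_cast_eq_one {l A : ℕ} (hA : 2 * A = l + 1) : (2 * A : ZMod l) = 1 := by
  have : ((2 * A : ℕ) : ZMod l) = ((l + 1 : ℕ) : ZMod l) := by rw [hA]
  simpa using this

theorem quadGaussSum_two_mul_one {l : ℕ} [NeZero l] [NeZero (2 * l)] {A : ℕ}
    (hA : 2 * A = l + 1) {h h' : ℤ} (hodd : Odd h) (hh : (h * h' : ZMod l) = -1) :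
    quadGaussSum (2 * l) h 1 =
      2 * (ZMod.stdAddChar (A ^ 3 * h' : ZMod l) * quadGaussSum l (A * h) 0) := by
  have h2A := two_mul_cast_eq_one hA
  have hterm : ∀ x : ℕ, ZMod.stdAddChar (h * x ^ 2 + 1 * x : ZMod (2 * l)) =
      ZMod.stdAddChar (A * (h * x ^ 2 + x) : ZMod l) := by
    intro x
    have h1 : (h * x ^ 2 + 1 * x : ZMod (2 * l)) = ((h * x ^ 2 + x : ℤ) : ZMod (2 * l)) := by
      push_cast; ring
    have h2 : Even (h * (x : ℤ) ^ 2 + x) := by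
      rcases Int.even_or_odd (x : ℤ) with hx | hx
      · exact ((hx.pow_of_ne_zero two_ne_zero).mul_left h).add hx
      · exact (hodd.mul hx.pow).add_odd hx
    rw [h1, stdAddChar_two_mul_modulus, exp_pi_mul_int_div l hA, h2.neg_one_zpow, one_mul]
    push_cast
    rfl
  have hsq : ∀ r : ZMod l, (A : ZMod l) * (h * r ^ 2 + r) =
      A ^ 3 * h' + A * h * (r - A * h') ^ 2 := by
    intro r
    linear_combination (-(A * r : ZMod l)) * h2A +
      (2 * A ^ 2 * r - A ^ 3 * h' : ZMod l) * hh
  calc quadGaussSum (2 * l) h 1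
      = ∑ x ∈ Finset.range (l + l), ZMod.stdAddChar (A * (h * x ^ 2 + x) : ZMod l) := by
        rw [quadGaussSum, ZMod.sum_univ_eq_sum_range, ← two_mul]
        exact Finset.sum_congr rfl fun x _ => hterm x
    _ = 2 * ∑ r : ZMod l, ZMod.stdAddChar (A * (h * r ^ 2 + r) : ZMod l) := by
        rw [Finset.sum_range_add, ZMod.sum_univ_eq_sum_range, two_mul]
        simp
    _ = 2 * ∑ r : ZMod l, ZMod.stdAddChar (A ^ 3 * h' + A * h * r ^ 2 : ZMod l) := by
        simp_rw [hsq]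
        congr 1
        exact Fintype.sum_equiv (Equiv.subRight (A * h' : ZMod l)) _ _ fun r => rfl
    _ = _ := by
        simp_rw [AddChar.map_add_eq_mul, ← Finset.mul_sum, quadGaussSum, zero_mul, add_zero]

theorem quadGaussSum_two_mul_even {l : ℕ} (hl : Odd l) [NeZero l] [NeZero (2 * l)] {h j : ℤ}
    (hodd : Odd h) (hj : Even j) : quadGaussSum (2 * l) h j = 0 := by
  have hl0 : (l : ℂ) ≠ 0 := by exact_mod_cast NeZero.ne l
  have hshift : ∀ r : ZMod (2 * l), ZMod.stdAddChar
      (h * (r + l) ^ 2 + j * (r + l) : ZMod (2 * l)) =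
        -ZMod.stdAddChar (h * r ^ 2 + j * r : ZMod (2 * l)) := by
    intro r
    have h2l : (2 * l : ZMod (2 * l)) = 0 := by exact_mod_cast ZMod.natCast_self (2 * l)
    obtain ⟨s, hs⟩ : Odd (h * l + j) := (hodd.mul (by exact_mod_cast hl)).add_even hj
    have hs' : (h * l + j : ZMod (2 * l)) = 2 * s + 1 := by exact_mod_cast congrArg _ hs
    have e : (h * (r + l) ^ 2 + j * (r + l) : ZMod (2 * l)) =
        (h * r ^ 2 + j * r) + ((l : ℤ) : ZMod (2 * l)) := by
      push_cast
      linear_combination (h * r + s : ZMod (2 * l)) * h2l + (l : ZMod (2 * l)) * hs'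
    rw [e, AddChar.map_add_eq_mul, stdAddChar_two_mul_modulus]
    push_cast
    rw [mul_div_cancel_right₀ _ hl0, exp_pi_mul_I, mul_neg_one]
  have : quadGaussSum (2 * l) h j = -quadGaussSum (2 * l) h j := by
    conv_lhs => rw [quadGaussSum, ← Equiv.sum_comp (Equiv.addRight (l : ZMod (2 * l)))]
    rw [quadGaussSum, ← Finset.sum_neg_distrib]
    exact Finset.sum_congr rfl fun r _ => hshift r
  exact self_eq_neg.mp this

theorem quadGaussSum_odd (N : ℕ) [NeZero N] {h h' : ℤ} (hh : (h * h' : ZMod N) = -1) (s : ℤ) :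
    quadGaussSum N h (2 * s + 1 : ℤ) =
      ZMod.stdAddChar ((h' * (s ^ 2 + s) : ℤ) : ZMod N) * quadGaussSum N h 1 := by
  rw [quadGaussSum, quadGaussSum, ← Equiv.sum_comp (Equiv.addRight (h' * s : ZMod N)), Finset.mul_sum]
  refine Finset.sum_congr rfl fun r _ => ?_
  rw [← AddChar.map_add_eq_mul, Equiv.coe_addRight]
  congr 1
  push_cast
  linear_combination (2 * s * r + h' * s ^ 2 : ZMod N) * hh

theorem tsum_quadGaussSum_eq_theta2 {l : ℕ} (hl : Odd l) [NeZero l] [NeZero (2 * l)] {h h' : ℤ}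
    (hodd : Odd h) (hh : (h * h' : ZMod (2 * l)) = -1) (τ : ℂ) :
    ∑' j : ℤ, quadGaussSum (2 * l) h j * cexp (Real.pi * I * (j : ℂ) ^ 2 *
      ((l * τ - h') / (4 * l))) =
      quadGaussSum (2 * l) h 1 * cexp (-(Real.pi * I * h' / (4 * l))) * theta2 τ := by
  have hl0 : (l : ℂ) ≠ 0 := by exact_mod_cast NeZero.ne l
  have hinj : Function.Injective fun n : ℤ => 2 * n - 1 := fun a b hab => by
    simp only at hab
    omega
  rw [theta2, ← tsum_mul_left, ← hinj.tsum_eq]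
  · refine tsum_congr fun n => ?_
    have e : (2 * n - 1 : ℤ) = 2 * (n - 1) + 1 := by ring
    rw [e, quadGaussSum_odd (2 * l) hh, stdAddChar_two_mul_modulus, mul_right_comm,
      ← Complex.exp_add, mul_comm, mul_assoc (quadGaussSum _ _ _), ← Complex.exp_add]
    congr 2
    push_cast
    field_simp
    ring
  · intro j hj
    rcases Int.even_or_odd' j with ⟨k, rfl | rfl⟩
    · exact absurd (by simp only [quadGaussSum_two_mul_even hl hodd (even_two_mul k), zero_mul]) hj
    · exact ⟨k + 1, by ring⟩

theorem neg_I_mul_cpow_half {w : ℂ} (hw : 0 < w.im) :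
    (-I * w) ^ (1 / 2 : ℂ) = cexp (-(Real.pi / 4 * I)) * w ^ (1 / 2 : ℂ) := by
  have hw0 : w ≠ 0 := by rintro rfl; simp at hw
  have hlog : log (-I * w) = log (-I) + log w := by
    rw [log_mul_eq_add_log_iff (by simp) hw0, arg_neg_I]
    have h1 : 0 ≤ arg w := arg_nonneg_iff.mpr hw.le
    have h2 := arg_le_pi w
    constructor <;> linarith [Real.pi_pos]
  rw [← neg_I_cpow_half, cpow_def_of_ne_zero (by simp [hw0]), hlog, add_mul, Complex.exp_add,
    cpow_def_of_ne_zero (by simp), cpow_def_of_ne_zero hw0]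

theorem neg_I_mul_neg_inv_cpow_half {c : ℝ} (hc : 0 < c) {w : ℂ} (hw : 0 < w.im) :
    (-I * (-1 / (c * w))) ^ (1 / 2 : ℂ) = ((√c : ℝ) * (-I * w) ^ (1 / 2 : ℂ))⁻¹ := by
  have hw0 : w ≠ 0 := by rintro rfl; simp at hw
  have hc0 : (c : ℂ) ≠ 0 := by exact_mod_cast hc.ne'
  have hre : 0 < (c * (-I * w)).re := by
    rw [re_ofReal_mul]
    simpa using mul_pos hc hw
  rw [← ofReal_mul_cpow_half hc, ← inv_cpow]
  · congr 1
    field_simp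
    simp
  · intro h
    rw [arg_eq_pi_iff] at h
    linarith [h.1]

theorem isThetaMultiplier_gammaInv {l : ℕ} (hl : Odd l) [NeZero l] [NeZero (2 * l)] {h h' : ℤ}
    (hodd : Odd h) (hh : (h * h' : ZMod (2 * l)) = -1) :
    IsThetaMultiplier (gammaInv l h h') (-I * ((√l : ℝ) / (2 * l)) *
      (quadGaussSum (2 * l) h 1 * cexp (-(Real.pi * I * h' / (4 * l))))) := by
  intro τ hτ
  have hl0 : (l : ℂ) ≠ 0 := by exact_mod_cast NeZero.ne l
  have hlr : (0 : ℝ) < l := by exact_mod_cast Nat.pos_of_neZero l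
  obtain ⟨b, hb⟩ : (l : ℤ) ∣ h * h' + 1 := by
    have : ((2 * l : ℕ) : ℤ) ∣ h * h' + 1 := by
      rw [← ZMod.intCast_zmod_eq_zero_iff_dvd]
      push_cast
      rw [hh, neg_add_cancel]
    exact (by push_cast; exact dvd_mul_left _ _ : (l : ℤ) ∣ ((2 * l : ℕ) : ℤ)).trans this
  have hbc : (h * h' + 1 : ℂ) = l * b := by exact_mod_cast hb
  have hdiv : (h * h' + 1) / (l : ℤ) = b := by
    rw [hb, Int.mul_ediv_cancel_left _ (by exact_mod_cast NeZero.ne l)]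
  set w : ℂ := l * τ - h' with hw
  have hwim : 0 < w.im := by
    have : w = (l : ℝ) * τ - (h' : ℝ) := by rw [hw]; push_cast; rfl
    rw [this, sub_im, ofReal_im, sub_zero, im_ofReal_mul]
    positivity
  have hw0 : w ≠ 0 := by intro h0; simp [h0] at hwim
  have hz : 0 < (-1 / ((l : ℝ) * w)).im := neg_one_div_im_pos (by
    rw [im_ofReal_mul]; positivity)
  have hmain := jacobiTheta_near_rational' (2 * l) h hz
  have e1 : (2 * (h : ℂ) / ((2 * l : ℕ) : ℂ) + -1 / ((l : ℝ) * w)) =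
      ((-h : ℤ) * τ + b) / ((-l : ℤ) * τ + h') := by
    have : ((-l : ℤ) * τ + h' : ℂ) = -w := by rw [hw]; push_cast; ring
    rw [this]
    push_cast
    field_simp
    rw [hw]
    linear_combination -hbc
  have e2 : -1 / (((2 * l : ℕ) : ℂ) ^ 2 * (-1 / ((l : ℝ) * w))) = (l * τ - h') / (4 * l) := by
    rw [← hw]
    push_cast
    field_simp
    norm_num
  rw [e1, e2, tsum_quadGaussSum_eq_theta2 hl hodd hh, neg_I_mul_neg_inv_cpow_half hlr hwim,
    neg_I_mul_cpow_half hwim] at hmain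
  have hE : cexp (-(Real.pi / 4 * I)) = -I * cexp (Real.pi / 4 * I) := by
    rw [← exp_neg_pi_div_two_mul_I, ← Complex.exp_add]
    congr 1
    ring
  have hsq : sqrtFactor (-l) h' τ = cexp (Real.pi / 4 * I) * w ^ (1 / 2 : ℂ) := by
    rw [sqrtFactor, hw]
    congr 2
    push_cast
    ring
  simp only [gammaInv, Matrix.of_apply, Matrix.cons_val', Matrix.cons_val_zero,
    Matrix.cons_val_one, Matrix.cons_val_fin_one, hdiv]
  rw [hmain, hsq, hE]
  push_cast
  rw [one_div, mul_inv, inv_inv]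
  field_simp

theorem theta2_I_ne_zero : theta2 I ≠ 0 := by
  have hterm : ∀ n : ℤ, cexp (Real.pi * I * ((n : ℂ) - 1 / 2) ^ 2 * I) =
      ((Real.exp (-(Real.pi * ((n : ℝ) - 1 / 2) ^ 2)) : ℝ) : ℂ) := by
    intro n
    push_cast
    congr 1
    linear_combination (Real.pi * ((n : ℂ) - 1 / 2) ^ 2) * I_sq
  have hsum : Summable fun n : ℤ => cexp (Real.pi * I * ((n : ℂ) - 1 / 2) ^ 2 * I) := by
    have := (hasSum_jacobiTheta₂_term (-I / 2) (τ := I) (by simp)).summable.mul_left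
      (cexp (Real.pi * I * I / 4))
    refine this.congr fun n => ?_
    rw [jacobiTheta₂_term, ← Complex.exp_add]
    congr 1
    ring
  rw [theta2, tsum_congr hterm, ← ofReal_tsum]
  simp_rw [hterm] at hsum
  exact_mod_cast ((Complex.summable_ofReal.mp hsum).tsum_pos (fun n => (Real.exp_pos _).le) 0
    (Real.exp_pos _)).ne'

theorem thetaMultiplier_eq {g : Matrix (Fin 2) (Fin 2) ℤ} (hg : g 1 0 ≠ 0) {κ : ℂ}
    (hκ : IsThetaMultiplier g κ) : thetaMultiplier g = κ := by
  have hex : ∃ κ, IsThetaMultiplier g κ := ⟨κ, hκ⟩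
  have h1 := hex.choose_spec I (by simp)
  have h2 := hκ I (by simp)
  have hs : sqrtFactor (g 1 0) (g 1 1) I ≠ 0 := by
    rw [sqrtFactor]
    refine mul_ne_zero (Complex.exp_ne_zero _) ?_
    rw [Ne, cpow_eq_zero_iff]
    rintro ⟨h0, -⟩
    have := congrArg Complex.im h0
    simp [hg] at this
  rw [thetaMultiplier, dif_pos hex]
  rw [h1] at h2
  exact mul_right_cancel₀ hs (mul_right_cancel₀ theta2_I_ne_zero h2)

theorem thetaMultiplier_gammaInv {l : ℕ} (hl : Odd l) [NeZero l] {A : ℕ} (hA : 2 * A = l + 1)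
    {h h' : ℤ} (hodd : Odd h) (hcop : IsCoprime h l) (hh : h * h' ≡ -1 [ZMOD (2 * l : ℕ)]) :
    thetaMultiplier (gammaInv l h h') = -I * J(A * h | l) * gaussEps l *
      (ZMod.stdAddChar (A ^ 3 * h' : ZMod l) * cexp (-(Real.pi * I * h' / (4 * l)))) := by
  have : NeZero (2 * l) := ⟨mul_ne_zero two_ne_zero (NeZero.ne l)⟩
  have hlc : (l : ℂ) ≠ 0 := by exact_mod_cast NeZero.ne l
  have hN : (h * h' : ZMod (2 * l)) = -1 := by
    exact_mod_cast (ZMod.intCast_eq_intCast_iff _ _ _).mpr hh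
  have hll : (h * h' : ZMod l) = -1 := by
    have : h * h' ≡ -1 [ZMOD (l : ℕ)] := hh.of_dvd (by push_cast; exact dvd_mul_left _ _)
    exact_mod_cast (ZMod.intCast_eq_intCast_iff _ _ _).mpr this
  have hAcop : IsCoprime (A : ℤ) l :=
    ⟨2, -1, by linear_combination (by exact_mod_cast hA : (2 * A : ℤ) = l + 1)⟩
  have hg := quadGaussSum_eq l hl (A * h) (hAcop.mul_left hcop)
  rw [Int.cast_mul, Int.cast_natCast] at hg
  have hs : ((√l : ℝ) : ℂ) * (√l : ℝ) = l := by
    exact_mod_cast Real.mul_self_sqrt (Nat.cast_nonneg l)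
  have hg0 : gammaInv l h h' 1 0 ≠ 0 := by
    simp [gammaInv, NeZero.ne l]
  rw [thetaMultiplier_eq hg0 (isThetaMultiplier_gammaInv hl hodd hN),
    quadGaussSum_two_mul_one hA hodd hll, hg]
  generalize cexp (-(Real.pi * I * h' / (4 * l))) = E
  field_simp
  linear_combination
    (-(ZMod.stdAddChar (A ^ 3 * h' : ZMod l) * J(A * h | l) * gaussEps l * E) : ℂ) * hs

theorem jacobiSym_cube (a : ℤ) (l : ℕ) : (J(a | l) : ℂ) ^ 3 = J(a | l) := by
  rcases jacobiSym.trichotomy a l with h | h | h <;> rw [h] <;> norm_num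

theorem gaussEps_cube_mul_jacobiSym {l : ℕ} (hl : Odd l) {A : ℕ} (hA : 2 * A = l + 1) :
    gaussEps l ^ 3 * J(A | l) = I ^ ((l - 1) / 2) := by
  have hJ : J(A | l) = ZMod.χ₈ l := by
    rw [← jacobiSym.at_two hl]
    have h1 : J(2 | l) * J(A | l) = 1 := by
      rw [← jacobiSym.mul_left, ← jacobiSym.one_left l]
      refine jacobiSym.mod_left' ?_
      rw [(by exact_mod_cast hA : (2 * A : ℤ) = l + 1), Int.add_emod_left]
    rcases Int.mul_eq_one_iff_eq_one_or_neg_one.mp h1 with ⟨h2, h3⟩ | ⟨h2, h3⟩ <;> rw [h2, h3]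
  have h3 : I ^ 3 = -I := I_pow_three
  rw [hJ, ZMod.χ₈_nat_eq_if_mod_eight, gaussEps]
  have hmod := Nat.odd_iff.mp hl
  obtain ⟨q, hq⟩ : ∃ q, q = l / 8 := ⟨_, rfl⟩
  have h8 : l % 8 = 1 ∨ l % 8 = 3 ∨ l % 8 = 5 ∨ l % 8 = 7 := by omega
  rcases h8 with h | h | h | h
  · simp [h, hmod, (by omega : l % 4 = 1), (by omega : (l - 1) / 2 = 4 * q), pow_mul]
  · simp [h, hmod, (by omega : l % 4 = 3), (by omega : (l - 1) / 2 = 4 * q + 1), pow_mul, pow_add]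
  · simp [h, hmod, (by omega : l % 4 = 1), (by omega : (l - 1) / 2 = 4 * q + 2), pow_mul, pow_add]
  · simp [h, hmod, (by omega : l % 4 = 3), (by omega : (l - 1) / 2 = 4 * q + 3), pow_mul, pow_add]

/-- The reduced residues modulo `2l` represent those modulo `l` exactly once, for `l` odd. -/
theorem sum_coprime_two_mul {M : Type*} [AddCommMonoid M] {l : ℕ} (hl : Odd l) {f : ℕ → M}
    (hf : ∀ h, f (h % l) = f h) :
    ∑ h ∈ (Finset.range (2 * l)).filter (fun h => Nat.Coprime h (2 * l)), f h =
      ∑ h ∈ (Finset.range l).filter (fun h => Nat.Coprime h l), f h := by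
  have hlo := Nat.odd_iff.mp hl
  have hiff : ∀ h, Nat.Coprime h (2 * l) ↔ h % 2 = 1 ∧ Nat.Coprime h l := fun h => by
    rw [Nat.coprime_mul_iff_right, Nat.coprime_two_right, Nat.odd_iff]
  refine Finset.sum_nbij (· % l) ?_ ?_ ?_ fun h _ => (hf h).symm
  · intro h hh
    simp only [Finset.mem_filter, Finset.mem_range, hiff] at hh ⊢
    exact ⟨Nat.mod_lt _ hl.pos, by simpa [Nat.Coprime] using hh.2.2⟩
  · intro a ha b hb hab
    simp only [Finset.coe_filter, Finset.mem_range, Set.mem_ofPred_eq, hiff] at ha hb hab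
    have hmod : a ≡ b [MOD 2 * l] :=
      (Nat.modEq_and_modEq_iff_modEq_mul (Nat.coprime_two_left.mpr hl)).mp
        ⟨ha.2.1.trans hb.2.1.symm, hab⟩
    exact hmod.eq_of_lt_of_lt ha.1 hb.1
  · intro r hr
    simp only [Finset.coe_filter, Finset.mem_range, Set.mem_ofPred_eq] at hr
    rcases Nat.mod_two_eq_zero_or_one r with h2 | h2
    · refine ⟨r + l, ?_, by simp [Nat.mod_eq_of_lt hr.1]⟩
      simp only [Finset.coe_filter, Finset.mem_range, Set.mem_ofPred_eq, hiff]
      exact ⟨by omega, by omega, by simpa using hr.2⟩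
    · refine ⟨r, ?_, Nat.mod_eq_of_lt hr.1⟩
      simp only [Finset.coe_filter, Finset.mem_range, Set.mem_ofPred_eq, hiff]
      exact ⟨by omega, h2, hr.2⟩

theorem salieSum_eq_sum_stdAddChar (a b : ℤ) (l : ℕ) [NeZero l] :
    salieSum a b l = ∑ h ∈ (Finset.range l).filter (fun h => Nat.Coprime h l),
      (J(h | l) : ℂ) * ZMod.stdAddChar (a * h + b * (h : ZMod l)⁻¹ : ZMod l) := by
  refine Finset.sum_congr rfl fun h _ => ?_
  have : (a * h + b * (h : ZMod l)⁻¹ : ZMod l) =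
      ((a * h + b * ((h : ZMod l)⁻¹).val : ℤ) : ZMod l) := by
    push_cast
    rw [ZMod.natCast_zmod_val]
  rw [this, ZMod.stdAddChar_coe]
  congr 2
  push_cast
  ring

theorem thetaMultiplier_gammaInv_cube_mul_exp {l : ℕ} (hl : Odd l) [NeZero l] {A : ℕ}
    (hA : 2 * A = l + 1) (m : ℤ) {h : ℕ} {h' : ℤ} (hcop : Nat.Coprime h (2 * l))
    (hh : (h : ℤ) * h' ≡ -1 [ZMOD (2 * l : ℕ)]) :
    thetaMultiplier (gammaInv l h h') ^ 3 *
      cexp (-2 * Real.pi * I * ((h' : ℂ) / (4 * (2 * (l : ℂ))) + m * h / (2 * (l : ℂ)))) =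
      -I * (-1) ^ m * (gaussEps l ^ 3 * J(A | l)) * (J(h | l) *
        ZMod.stdAddChar (((-4 * m * A ^ 3 : ℤ) : ZMod l) * h +
          ((A ^ 3 : ℤ) : ZMod l) * (h : ZMod l)⁻¹ : ZMod l)) := by
  have hlc : (l : ℂ) ≠ 0 := by exact_mod_cast NeZero.ne l
  rw [Nat.coprime_mul_iff_right, Nat.coprime_two_right] at hcop
  have hodd : Odd (h : ℤ) := by exact_mod_cast hcop.1
  have hodd' : Odd h' := by
    have h2 : (h : ℤ) * h' ≡ -1 [ZMOD 2] := hh.of_dvd (by push_cast; exact dvd_mul_right _ _)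
    have : Odd ((h : ℤ) * h') := by
      rw [Int.odd_iff, h2]
      rfl
    exact (Int.odd_mul.mp this).2
  have hll : (h * h' : ZMod l) = -1 := by
    have : (h : ℤ) * h' ≡ -1 [ZMOD (l : ℕ)] := hh.of_dvd (by push_cast; exact dvd_mul_left _ _)
    exact_mod_cast (ZMod.intCast_eq_intCast_iff _ _ _).mpr this
  have hinv : (h : ZMod l)⁻¹ = -h' := by
    have h1 := ZMod.coe_mul_inv_eq_one h hcop.2
    linear_combination ((h : ZMod l)⁻¹) * hll + (-h' : ZMod l) * h1
  rw [thetaMultiplier_gammaInv hl hA hodd (Nat.isCoprime_iff_coprime.mpr hcop.2) hh,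
    jacobiSym.mul_left]
  have hsign : (-1 : ℂ) ^ (-h' - m * h) = -(-1) ^ m := by
    have h1 : Even (-h' - m * h - (m + 1)) := by
      have : -h' - m * h - (m + 1) = -(h' + 1) - m * (h + 1) := by ring
      rw [this]
      exact (hodd'.add_one.neg).sub ((hodd.add_one).mul_left m)
    have h2 : -h' - m * h = (-h' - m * h - (m + 1)) + (m + 1) := by ring
    rw [h2, zpow_add₀ (by norm_num), h1.neg_one_zpow, zpow_add_one₀ (by norm_num)]
    ring
  have hexp : cexp (-(Real.pi * I * h' / (4 * l))) ^ 3 *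
      cexp (-2 * Real.pi * I * ((h' : ℂ) / (4 * (2 * (l : ℂ))) + m * h / (2 * (l : ℂ)))) =
      -(-1) ^ m * ZMod.stdAddChar ((A * (-h' - m * h) : ℤ) : ZMod l) := by
    rw [← hsign, ← exp_pi_mul_int_div l hA, ← Complex.exp_nat_mul, ← Complex.exp_add]
    congr 1
    push_cast
    field_simp
    ring
  have hchar : ZMod.stdAddChar (A ^ 3 * h' : ZMod l) ^ 3 *
      ZMod.stdAddChar ((A * (-h' - m * h) : ℤ) : ZMod l) =
        ZMod.stdAddChar (((-4 * m * A ^ 3 : ℤ) : ZMod l) * h +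
          ((A ^ 3 : ℤ) : ZMod l) * (h : ZMod l)⁻¹ : ZMod l) := by
    rw [← AddChar.map_nsmul_eq_pow, ← AddChar.map_add_eq_mul, hinv]
    congr 1
    push_cast
    rw [nsmul_eq_mul]
    push_cast
    have h2A := two_mul_cast_eq_one hA
    linear_combination (A * (2 * A + 1) * (h' + m * h) : ZMod l) * h2A
  have hJ := jacobiSym_cube A l
  have hJ' := jacobiSym_cube h l
  rw [← hchar, Int.cast_mul]
  simp only [mul_pow, hJ, hJ']
  have hI : (-I) ^ 3 = I := by rw [Odd.neg_pow (by decide), I_pow_three, neg_neg]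
  rw [hI]
  linear_combination (I * J(A | l) * J(h | l) * gaussEps l ^ 3 *
    ZMod.stdAddChar (A ^ 3 * h' : ZMod l) ^ 3 : ℂ) * hexp

theorem mainTheorem8 (l : ℕ) (hl : Odd l) (A : ℕ) (hA : A = (l + 1) / 2) (m : ℤ)
    (h' : ℕ → ℤ)
    (hh' : ∀ h : ℕ, Nat.Coprime h (2 * l) → (h : ℤ) * h' h ≡ -1 [ZMOD (2 * l : ℕ)]) :
    arithFactor l h' m =
      (-1 : ℂ) ^ (m - 1) * Complex.I ^ ((l - 1) / 2) *
        salieSum (-4 * m * (A : ℤ) ^ 3) ((A : ℤ) ^ 3) l := by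
  have : NeZero l := ⟨hl.pos.ne'⟩
  have hA2 : 2 * A = l + 1 := by
    have := Nat.odd_iff.mp hl
    omega
  have hperiod : ∀ h : ℕ, (J((h % l : ℕ) | l) : ℂ) *
      ZMod.stdAddChar (((-4 * m * A ^ 3 : ℤ) : ZMod l) * (h % l : ℕ) +
        ((A ^ 3 : ℤ) : ZMod l) * ((h % l : ℕ) : ZMod l)⁻¹ : ZMod l) =
      J(h | l) * ZMod.stdAddChar (((-4 * m * A ^ 3 : ℤ) : ZMod l) * h +
        ((A ^ 3 : ℤ) : ZMod l) * (h : ZMod l)⁻¹ : ZMod l) := by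
    intro h
    rw [ZMod.natCast_mod, Int.natCast_mod, ← jacobiSym.mod_left]
  rw [arithFactor, salieSum_eq_sum_stdAddChar, ← sum_coprime_two_mul hl hperiod,
    ← gaussEps_cube_mul_jacobiSym hl hA2, Finset.mul_sum, Finset.mul_sum]
  refine Finset.sum_congr rfl fun h hh => ?_
  have hcop := (Finset.mem_filter.mp hh).2
  rw [thetaMultiplier_gammaInv_cube_mul_exp hl hA2 m hcop (hh' h hcop),
    zpow_sub_one₀ (by norm_num), inv_neg_one]
  linear_combination ((-1) ^ m * (gaussEps l ^ 3 * J(A | l)) * (J(h | l) *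
        ZMod.stdAddChar (((-4 * m * A ^ 3 : ℤ) : ZMod l) * h +
          ((A ^ 3 : ℤ) : ZMod l) * (h : ZMod l)⁻¹ : ZMod l)) : ℂ) * I_sq
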